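/- **The calculus.** Terms of the $\lambda_c$-calculus are given (up to $\alpha$-equivalence) by $t,u ::= x \mid tu \mid \lambda x.t \mid \mathsf{cc} \mid k_\pi \mid \mathsf a_n \mid \mathsf b_n$ ($\pi$ a stack, $n\in\mathbb N$; the $\mathsf a_n$ and $\mathsf b_n$ are the nonrestricted and the restricted instructions), stacks by $\pi ::= \omega_n \mid t\cdot\pi$ ($n \in \mathbb N$, $t$ closed), and processes are the pairs $t\star\pi$ of a closed term and a stack. Let $\Lambda$ be the set of closed terms, $\Pi$ the set of stacks and $\mathbf P$ the set of processes. One-step evaluation $\succ_1$ is given by $$tu\star\pi\succ_1 t\star u\cdot\pi,\quad \lambda x.t\star u\cdot\pi\succ_1 t[x:=u]\star\pi,\quad \mathsf{cc}\star t\cdot\pi\succ_1 t\star k_\pi\cdot\pi,\quad k_{\pi'}\star t\cdot\pi\succ_1 t\star\pi'.$$ A *pole* is a set $\bot\!\!\!\bot\subseteq\mathbf P$ such that $p\in\bot\!\!\!\bot$ whenever $p$ evaluates to some $q\in\bot\!\!\!\bot$ in finitely many (possibly zero) steps. A *realizability structure* $\mathcal S$ is a set of poles. A closed term is *proof-like*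 if it contains no $k_\pi$ and no $\mathsf b_n$. **Formulas.** First-order terms are built from variables and all functions $\mathbb N^n\to\mathbb N$. Formulas are $$A,B ::= X(\vec a)\mid\top\mid\bot\mid A\to B\mid\forall x\,A\mid\forall X\,A\mid (a=b)\hookrightarrow A\mid A\cap B\mid A\cup B\mid F(\vec a),$$ where $X$ is an $n$-ary relational variable, $F:\mathbb N^n\to\mathcal P(\Pi)$ and $\vec a$ is an $n$-tuple of first-order terms. For a pole $\bot\!\!\!\bot$ and a closed formula $A$, the falsity value $\|A\|\subseteq\Pi$ is defined by $\|\top\|=\emptyset$; $\|\bot\|=\Pi$; $\|A\to B\|=\{t\cdot\pi : t\in|A|,\ \pi\in\|B\|\}$, where $|A|=\{t\in\Lambda : \forall\pi\in\|A\|,\ t\star\pi\in\bot\!\!\!\bot\}$; $\|\forall x\,A\|=\bigcup_{m\in\mathbb N}\|A[x:=m]\|$; $\|\forall X\,A\|=\bigcup_{F:\mathbb N^n\to\mathcal P(\Pi)}\|A[X:=F]\|$ for $X$ of arity $n$; $\|(a=b)\hookrightarrow A\|$ is $\|A\|$ if $a$ and $b$ have the same value and $\emptyset$ otherwise; $\|A\cap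 B\|=\|A\|\cup\|B\|$; $\|A\cup B\|=\|A\|\cap\|B\|$; $\|F(\vec a)\|=F(\text{the values of }\vec a)$. The *theory* of $\mathcal S$ is the set of closed formulas $A$ for which some single proof-like term $t$ satisfies $t\in|A|$ for every pole of $\mathcal S$; write $\mathrm{Th}(\mathcal S)\models A$ for membership. **The cardinality of $\gimel 2$.** Let $a=b$ stand for $\forall Z\,(Z(a)\to Z(b))$, $A\wedge B$ for $\forall Z\,((A\to B\to Z)\to Z)$, $A\vee B$ for $\forall Z\,((A\to Z)\to(B\to Z)\to Z)$, and $\forall x^{\gimel 2}A$ for $\forall x\,\big((\min(x+1,2)=x+1)\hookrightarrow A\big)$. For $n\ge1$, let $|\gimel2|<n$ be the formula $\forall x_1^{\gimel 2}\cdots\forall x_n^{\gimel 2}\ \bigvee_{i\ne j}(x_i=x_j)$ (an empty disjunction being $\bot$), let $|\gimel 2|\ge n$ be $(|\gimel 2|<n)\to\bot$, and let $|\gimel 2|=n$ be $(|\gimel 2|\ge n)\wedge(|\gimel 2|<n+1)$. **Fork.** The evaluation relation $\succ_{\mathcal S}$ associated with $\mathcal S$ is the binary relation on $\mathcal P(\mathbf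 P)$ defined by: $P\succ_{\mathcal S}Q$ if and only if for every $\bot\!\!\!\bot\in\mathcal S$, $Q\subseteq\bot\!\!\!\bot$ implies $P\cap\bot\!\!\!\bot\ne\emptyset$. A *fork instruction* modulo $\succ_{\mathcal S}$ is a closed term $\psi$ such that, for all closed terms $u,v$ and all stacks $\pi$, $\{\psi\star u\cdot v\cdot\pi\}\succ_{\mathcal S}\{u\star\pi\}$ and $\{\psi\star u\cdot v\cdot\pi\}\succ_{\mathcal S}\{v\star\pi\}$. **Proposition.** Let $\mathcal S$ be a realizability structure. Then $\mathrm{Th}(\mathcal S)\models\ |\gimel 2|=2$ if and only if there exists a proof-like fork instruction modulo $\succ_{\mathcal S}$. -/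

import Mathlib

namespace LambdaC

/-! ### The calculus: terms, stacks, processes

Syntax modulo renaming of bound variables is represented by well-scoped de Bruijn indices:
`Term n` is the set of terms whose free variables are among `n` given ones. -/

mutual
/-- Terms with at most `n` free variables; `var 0` is the innermost one. -/
inductive Term : ℕ → Type
  | var {n : ℕ} (i : Fin n) : Term n
  | app {n : ℕ} (t u : Term n) : Term n
  | lam {n : ℕ} (t : Term (n + 1)) : Term n
  /-- call-with-current-continuation -/
  | cc {n : ℕ} : Term n
  /-- continuation constants -/
  | kont {n : ℕ} (π : Stack) : Term n
  /-- nonrestricted instructions -/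
  | instrA {n : ℕ} (i : ℕ) : Term n
  /-- restricted instructions -/
  | instrB {n : ℕ} (i : ℕ) : Term n
/-- Stacks of closed terms, with countably many stack bottoms. -/
inductive Stack : Type
  | bottom (i : ℕ) : Stack
  | cons (t : Term 0) (π : Stack) : Stack
end

/-- A process `t ⋆ π`. -/
structure Proc where
  head : Term 0
  stack : Stack

/-- Renaming of variables. -/
def Term.rename : {n m : ℕ} → (Fin n → Fin m) → Term n → Term m
  | _, _, r, .var i => .var (r i)
  | _, _, r, .app t u => .app (t.rename r) (u.rename r)
  | _, _, r, .lam t => .lam (t.rename (Fin.cases 0 fun i => (r i).succ))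
  | _, _, _, .cc => .cc
  | _, _, _, .kont π => .kont π
  | _, _, _, .instrA i => .instrA i
  | _, _, _, .instrB i => .instrB i

/-- Simultaneous capture-avoiding substitution. -/
def Term.subst : {n m : ℕ} → (Fin n → Term m) → Term n → Term m
  | _, _, s, .var i => s i
  | _, _, s, .app t u => .app (t.subst s) (u.subst s)
  | _, _, s, .lam t => .lam (t.subst (Fin.cases (.var 0) fun i => (s i).rename Fin.succ))
  | _, _, _, .cc => .cc
  | _, _, _, .kont π => .kont π
  | _, _, _, .instrA i => .instrA i
  | _, _, _, .instrB i => .instrB i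

/-- `t[x := u]`, where `x` is the only variable that may be free in `t`. -/
def Term.inst (t : Term 1) (u : Term 0) : Term 0 := t.subst fun _ => u

/-- One-step evaluation. -/
inductive Step : Proc → Proc → Prop
  | push (t u : Term 0) (π : Stack) : Step ⟨.app t u, π⟩ ⟨t, .cons u π⟩
  | grab (t : Term 1) (u : Term 0) (π : Stack) : Step ⟨.lam t, .cons u π⟩ ⟨t.inst u, π⟩
  | save (t : Term 0) (π : Stack) : Step ⟨.cc, .cons t π⟩ ⟨t, .cons (.kont π) π⟩
  | restore (π' : Stack) (t : Term 0) (π : Stack) : Step ⟨.kont π', .cons t π⟩ ⟨t, π'⟩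

/-- The evaluation preorder: the reflexive transitive closure of one-step evaluation. -/
def Evaluates : Proc → Proc → Prop := Relation.ReflTransGen Step

/-- Proof-like terms: no continuation constant and no restricted instruction occurs. -/
def Term.ProofLike : {n : ℕ} → Term n → Prop
  | _, .var _ => True
  | _, .app t u => t.ProofLike ∧ u.ProofLike
  | _, .lam t => t.ProofLike
  | _, .cc => True
  | _, .kont _ => False
  | _, .instrA _ => True
  | _, .instrB _ => False

/-- Poles: sets of processes closed by anti-evaluation. -/
structure Pole where
  carrier : Set Proc
  anti_eval : ∀ p q : Proc, Evaluates p q → q ∈ carrier → p ∈ carrier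

/-- A realizability structure is a set of poles. -/
abbrev RealizabilityStructure : Type := Set Pole

/-- The dual of a set of stacks with respect to a pole. -/
def Pole.dual (P : Pole) (X : Set Stack) : Set (Term 0) :=
  {t | ∀ π ∈ X, (⟨t, π⟩ : Proc) ∈ P.carrier}

/-! ### The realizability language

`Formula k Γ` is the set of formulas (modulo renaming of bound variables) whose free first-order
variables are among `k` given ones and whose free relational variables are among given ones, the
list of whose arities is `Γ`. In particular, `Formula 0 []` is the set of closed formulas. -/

/-- First-order terms: every function `ℕⁿ → ℕ` is a function symbol. -/
inductive FOTerm (k : ℕ) : Type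
  | var (i : Fin k) : FOTerm k
  | app {n : ℕ} (f : (Fin n → ℕ) → ℕ) (a : Fin n → FOTerm k) : FOTerm k

/-- `RelVar Γ n` is the set of `n`-ary variables of the context `Γ`. -/
inductive RelVar : List ℕ → ℕ → Type
  | here {Γ : List ℕ} {n : ℕ} : RelVar (n :: Γ) n
  | there {Γ : List ℕ} {n m : ℕ} (X : RelVar Γ n) : RelVar (m :: Γ) n

inductive Formula : ℕ → List ℕ → Type
  | rel {k : ℕ} {Γ : List ℕ} {n : ℕ} (X : RelVar Γ n) (a : Fin n → FOTerm k) : Formula k Γ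
  | top {k : ℕ} {Γ : List ℕ} : Formula k Γ
  | bot {k : ℕ} {Γ : List ℕ} : Formula k Γ
  | imp {k : ℕ} {Γ : List ℕ} (A B : Formula k Γ) : Formula k Γ
  /-- First-order quantification; the bound variable is the last one of `A`. -/
  | all1 {k : ℕ} {Γ : List ℕ} (A : Formula (k + 1) Γ) : Formula k Γ
  /-- Quantification over an `n`-ary relational variable. -/
  | all2 {k : ℕ} {Γ : List ℕ} (n : ℕ) (A : Formula k (n :: Γ)) : Formula k Γ
  /-- Equational implication `(a = b) ↪ A`. -/
  | eqImp {k : ℕ} {Γ : List ℕ} (a b : FOTerm k) (A : Formula k Γ) : Formula k Γ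
  | inter {k : ℕ} {Γ : List ℕ} (A B : Formula k Γ) : Formula k Γ
  | union {k : ℕ} {Γ : List ℕ} (A B : Formula k Γ) : Formula k Γ
  | param {k : ℕ} {Γ : List ℕ} {n : ℕ} (F : (Fin n → ℕ) → Set Stack) (a : Fin n → FOTerm k) :
      Formula k Γ

/-- The value of a first-order term. -/
def FOTerm.value {k : ℕ} (ρ : Fin k → ℕ) : FOTerm k → ℕ
  | .var i => ρ i
  | .app f a => f fun i => (a i).value ρ

/-- Assignments of falsity functions to the relational variables of `Γ`. -/
def RelEnv (Γ : List ℕ) : Type := ∀ n : ℕ, RelVar Γ n → (Fin n → ℕ) → Set Stack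

def RelEnv.nil : RelEnv [] := fun _ X => nomatch X

def RelEnv.cons {Γ : List ℕ} {m : ℕ} (F : (Fin m → ℕ) → Set Stack) (e : RelEnv Γ) :
    RelEnv (m :: Γ)
  | _, .here => F
  | _, .there X => e _ X

/-- The falsity value of a formula with respect to a pole. The instantiation of free variables by
integers `m` and by functions `F : ℕⁿ → 𝒫(Π)` is carried by the assignments `ρ` and `e`. -/
def Formula.falsity (P : Pole) :
    {k : ℕ} → {Γ : List ℕ} → Formula k Γ → (Fin k → ℕ) → RelEnv Γ → Set Stack
  | _, _, .rel X a, ρ, e => e _ X fun i => (a i).value ρ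
  | _, _, .top, _, _ => ∅
  | _, _, .bot, _, _ => Set.univ
  | _, _, .imp A B, ρ, e =>
      {σ | ∃ t ∈ P.dual (A.falsity P ρ e), ∃ π ∈ B.falsity P ρ e, σ = .cons t π}
  | _, _, .all1 A, ρ, e => ⋃ m : ℕ, A.falsity P (Fin.snoc (α := fun _ => ℕ) ρ m) e
  | _, _, .all2 n A, ρ, e => ⋃ F : (Fin n → ℕ) → Set Stack, A.falsity P ρ (e.cons F)
  | _, _, .eqImp a b A, ρ, e => {π | a.value ρ = b.value ρ ∧ π ∈ A.falsity P ρ e}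
  | _, _, .inter A B, ρ, e => A.falsity P ρ e ∪ B.falsity P ρ e
  | _, _, .union A B, ρ, e => A.falsity P ρ e ∩ B.falsity P ρ e
  | _, _, .param F a, ρ, _ => F fun i => (a i).value ρ

/-- The closed term `t` realizes the closed formula `A` with respect to the pole `P`. -/
def Realizes (P : Pole) (t : Term 0) (A : Formula 0 []) : Prop :=
  t ∈ P.dual (A.falsity P Fin.elim0 RelEnv.nil)

/-- The theory generated by a realizability structure. -/
def theory (S : RealizabilityStructure) : Set (Formula 0 []) :=
  {A | ∃ t : Term 0, t.ProofLike ∧ ∀ P ∈ S, Realizes P t A}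

/-! ### Encoded connectives -/

/-- Extension of a renaming of relational variables under a second-order quantifier. -/
def RelVar.liftRen {Γ Δ : List ℕ} {m : ℕ} (r : ∀ n, RelVar Γ n → RelVar Δ n) :
    ∀ n, RelVar (m :: Γ) n → RelVar (m :: Δ) n
  | _, .here => .here
  | _, .there X => .there (r _ X)

/-- Renaming of the relational variables of a formula. -/
def Formula.rename : {k : ℕ} → {Γ Δ : List ℕ} → (∀ n, RelVar Γ n → RelVar Δ n) →
    Formula k Γ → Formula k Δ
  | _, _, _, r, .rel X a => .rel (r _ X) a
  | _, _, _, _, .top => .top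
  | _, _, _, _, .bot => .bot
  | _, _, _, r, .imp A B => .imp (A.rename r) (B.rename r)
  | _, _, _, r, .all1 A => .all1 (A.rename r)
  | _, _, _, r, .all2 n A => .all2 n (A.rename (RelVar.liftRen r))
  | _, _, _, r, .eqImp a b A => .eqImp a b (A.rename r)
  | _, _, _, r, .inter A B => .inter (A.rename r) (B.rename r)
  | _, _, _, r, .union A B => .union (A.rename r) (B.rename r)
  | _, _, _, _, .param F a => .param F a

/-- The formula `A`, seen in a context with one more (fresh) relational variable. -/
def Formula.weaken {k : ℕ} {Γ : List ℕ} (m : ℕ) (A : Formula k Γ) : Formula k (m :: Γ) :=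
  A.rename fun _ X => .there X

/-- The innermost relational variable, when it is propositional. -/
def Formula.z {k : ℕ} {Γ : List ℕ} : Formula k (0 :: Γ) := .rel .here Fin.elim0

/-- `a = b` is `∀ Z, Z(a) → Z(b)`. -/
def Formula.eq {k : ℕ} {Γ : List ℕ} (a b : FOTerm k) : Formula k Γ :=
  .all2 1 (.imp (.rel .here fun _ => a) (.rel .here fun _ => b))

/-- `a ≠ b` is `(a = b) ↪ ⊥`. -/
def Formula.ne {k : ℕ} {Γ : List ℕ} (a b : FOTerm k) : Formula k Γ := .eqImp a b .bot

/-- `A ∧ B` is `∀ Z, (A → B → Z) → Z`. -/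
def Formula.and {k : ℕ} {Γ : List ℕ} (A B : Formula k Γ) : Formula k Γ :=
  .all2 0 (.imp (.imp (A.weaken 0) (.imp (B.weaken 0) .z)) .z)

/-- `A ∨ B` is `∀ Z, (A → Z) → (B → Z) → Z`. -/
def Formula.or {k : ℕ} {Γ : List ℕ} (A B : Formula k Γ) : Formula k Γ :=
  .all2 0 (.imp (.imp (A.weaken 0) .z) (.imp (.imp (B.weaken 0) .z) .z))

/-! ### The characteristic Boolean algebra and its cardinality -/

/-- The integer `m`, as a constant. -/
def FOTerm.num {k : ℕ} (m : ℕ) : FOTerm k := .app (n := 0) (fun _ => m) Fin.elim0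

/-- Application of a unary function symbol. -/
def FOTerm.app1 {k : ℕ} (f : ℕ → ℕ) (a : FOTerm k) : FOTerm k :=
  .app (n := 1) (fun v => f (v 0)) fun _ => a

/-- Application of a binary function symbol. -/
def FOTerm.app2 {k : ℕ} (f : ℕ → ℕ → ℕ) (a b : FOTerm k) : FOTerm k :=
  .app (n := 2) (fun v => f (v 0) (v 1)) ![a, b]

/-- `∀ x^{ℷn} A`, that is `∀ x, ℷn(x) ↪ A`, where `ℷn(x)` is `x + 1 ≤ n`, and `a ≤ b` is
`min(a, b) = a`. -/
def Formula.allGim {k : ℕ} {Γ : List ℕ} (n : ℕ) (A : Formula (k + 1) Γ) : Formula k Γ :=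
  let a : FOTerm (k + 1) := .app2 (· + ·) (.var (Fin.last k)) (.num 1)
  .all1 (.eqImp (.app2 min a (.num n)) a A)

/-- Terms of the language of Boolean algebras. -/
inductive BoolTerm (k : ℕ) : Type
  | var (i : Fin k) : BoolTerm k
  | zero : BoolTerm k
  | one : BoolTerm k
  | sup (a b : BoolTerm k) : BoolTerm k
  | inf (a b : BoolTerm k) : BoolTerm k
  | neg (a : BoolTerm k) : BoolTerm k

/-- Formulas of the language of Boolean algebras with at most `k` free variables; the variable
bound in `all A` is the last one of `A`. -/
inductive BoolFormula : ℕ → Type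
  | top {k : ℕ} : BoolFormula k
  | bot {k : ℕ} : BoolFormula k
  | ne {k : ℕ} (a b : BoolTerm k) : BoolFormula k
  | eq {k : ℕ} (a b : BoolTerm k) : BoolFormula k
  | imp {k : ℕ} (A B : BoolFormula k) : BoolFormula k
  | or {k : ℕ} (A B : BoolFormula k) : BoolFormula k
  | and {k : ℕ} (A B : BoolFormula k) : BoolFormula k
  | all {k : ℕ} (A : BoolFormula (k + 1)) : BoolFormula k

/-- The operations are those of `{0, 1}`, extended to all integers. -/
def BoolTerm.toFO {k : ℕ} : BoolTerm k → FOTerm k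
  | .var i => .var i
  | .zero => .num 0
  | .one => .num 1
  | .sup a b => .app2 (fun m n => if 0 < m ∨ 0 < n then 1 else 0) a.toFO b.toFO
  | .inf a b => .app2 (fun m n => if 0 < m ∧ 0 < n then 1 else 0) a.toFO b.toFO
  | .neg a => .app1 (fun m => if m = 0 then 1 else 0) a.toFO

/-- `ℷ2 ⊨ A`: the formula `A` with all quantifiers relativized to `ℷ2`. -/
def BoolFormula.inGim2 : {k : ℕ} → BoolFormula k → Formula k []
  | _, .top => .top
  | _, .bot => .bot
  | _, .ne a b => .ne a.toFO b.toFO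
  | _, .eq a b => .eq a.toFO b.toFO
  | _, .imp A B => .imp A.inGim2 B.inGim2
  | _, .or A B => .or A.inGim2 B.inGim2
  | _, .and A B => .and A.inGim2 B.inGim2
  | _, .all A => .allGim 2 A.inGim2

/-- Left-associated iterated disjunction (the empty one is `⊥`). -/
def BoolFormula.bigOr {k : ℕ} : List (BoolFormula k) → BoolFormula k
  | [] => .bot
  | A :: l => l.foldl .or A

/-- `∀ x₁ … xₙ, A`, where `xᵢ` is the `i`-th variable of `A`. -/
def BoolFormula.allClosure : {n : ℕ} → BoolFormula n → BoolFormula 0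
  | 0, A => A
  | _ + 1, A => A.all.allClosure

/-- `∀ x₁ … xₙ, ⋁_{i ≠ j} xᵢ = xⱼ`: there are fewer than `n` elements. -/
def BoolFormula.cardLt (n : ℕ) : BoolFormula 0 :=
  (bigOr (((List.finRange n ×ˢ List.finRange n).filter fun p => p.1 ≠ p.2).map fun p =>
    .eq (.var p.1) (.var p.2))).allClosure

/-- `|ℷ2| < n` -/
def gimLt (n : ℕ) : Formula 0 [] := (BoolFormula.cardLt n).inGim2

/-- `|ℷ2| ≥ n` -/
def gimGe (n : ℕ) : Formula 0 [] := .imp (gimLt n) .bot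

/-- `|ℷ2| = n` -/
def gimEq (n : ℕ) : Formula 0 [] := .and (gimGe n) (gimLt (n + 1))

/-! ### Multi-evaluation relations and fork -/

/-- Multi-evaluation relations. -/
structure MultiEval where
  rel : Set Proc → Set Proc → Prop
  step : ∀ p q : Proc, Step p q → rel {p} {q}
  identity : ∀ p : Proc, rel {p} {p}
  cut : ∀ (P Q P' Q' : Set Proc) (r : Proc),
    rel P (Q ∪ {r}) → rel (P' ∪ {r}) Q' → rel (P ∪ P') (Q ∪ Q')
  weakening : ∀ P Q P' Q' : Set Proc, rel P Q → P ⊆ P' → Q ⊆ Q' → rel P' Q'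

/-- The evaluation relation associated with a realizability structure. -/
def evalRel (S : RealizabilityStructure) : MultiEval where
  rel P Q := ∀ pole ∈ S, Q ⊆ pole.carrier → (P ∩ pole.carrier).Nonempty
  step p q h pole _ hq :=
    ⟨p, rfl, pole.anti_eval p q (Relation.ReflTransGen.single h) (hq rfl)⟩
  identity p _ _ hp := ⟨p, rfl, hp rfl⟩
  cut P Q P' Q' r h h' pole hS hQ := by
    by_cases hr : r ∈ pole.carrier
    · obtain ⟨p, hp, hp'⟩ := h pole hS
        (Set.union_subset (Set.subset_union_left.trans hQ) (Set.singleton_subset_iff.2 hr))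
      exact ⟨p, Or.inl hp, hp'⟩
    · obtain ⟨p, hp | hp, hp'⟩ := h' pole hS (Set.subset_union_right.trans hQ)
      · exact ⟨p, Or.inr hp, hp'⟩
      · exact absurd (Set.mem_singleton_iff.1 hp ▸ hp') hr
  weakening _ _ _ _ h hP hQ pole hS hQ' :=
    (h pole hS (hQ.trans hQ')).mono (Set.inter_subset_inter_left _ hP)

/-- Fork instructions (may-nondeterministic choice operators) modulo an evaluation relation. -/
def IsFork (E : MultiEval) (ψ : Term 0) : Prop :=
  ∀ (u v : Term 0) (π : Stack),
    E.rel {⟨ψ, .cons u (.cons v π)⟩} {⟨u, π⟩} ∧ E.rel {⟨ψ, .cons u (.cons v π)⟩} {⟨v, π⟩}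

end LambdaC

namespace LambdaC

/-! ### Substitution in closed terms -/

-- The conjunct `|ℷ2| ≥ 2` is realized in every pole by the fixed proof-like term `gimGeTwo`, so all
-- the content lies in `|ℷ2| < 3`. First-order quantifiers are interpreted uniformly: a realizer of
-- `|ℷ2| < 3` is one term that realizes the disjunction of the `xᵢ = xⱼ` for each of the eight
-- triples of bits, without being told which triple it faces.
--
-- Given a fork, the pigeonhole principle suffices: two of three bits agree, and forking between the
-- injections for `x₀ = x₁`, `x₀ = x₂` and `x₁ = x₂` yields a realizer as soon as one of the three
-- is correct (`gimLtThree_mem`, via `app_app_fork_mem`).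
--
-- Conversely, let `t` realize `|ℷ2| < 3`, and analyse `t` by cases, answering `u` if `x₀ = x₁` and
-- `v` if `x₀ = x₂`. Read at the triple (0,0,1) the resulting term behaves like `u`, read at (0,1,0)
-- like `v`. Since it is the same term, it is accepted on a stack whenever either `u` or `v` is,
-- which is a fork (`fork_mem`). Both constructions are independent of the pole and preserve
-- proof-likeness.

theorem Term.subst_rename : ∀ {n m l : ℕ} (t : Term n) (r : Fin n → Fin m) (s : Fin m → Term l),
    (t.rename r).subst s = t.subst fun i => s (r i)
  | _, _, _, .var i, r, s => by simp [Term.rename, Term.subst]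
  | _, _, _, .app t u, r, s => by
      simp [Term.rename, Term.subst, Term.subst_rename t, Term.subst_rename u]
  | _, _, _, .lam t, r, s => by
      simp only [Term.rename, Term.subst, Term.subst_rename t]
      congr 2
      funext i
      cases i using Fin.cases <;> rfl
  | _, _, _, .cc, r, s => by simp [Term.rename, Term.subst]
  | _, _, _, .kont π, r, s => by simp [Term.rename, Term.subst]
  | _, _, _, .instrA i, r, s => by simp [Term.rename, Term.subst]
  | _, _, _, .instrB i, r, s => by simp [Term.rename, Term.subst]

theorem Term.rename_rename : ∀ {n m l : ℕ} (t : Term n) (r : Fin n → Fin m) (s : Fin m → Fin l),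
    (t.rename r).rename s = t.rename fun i => s (r i)
  | _, _, _, .var i, r, s => by simp [Term.rename]
  | _, _, _, .app t u, r, s => by
      simp [Term.rename, Term.rename_rename t, Term.rename_rename u]
  | _, _, _, .lam t, r, s => by
      simp only [Term.rename, Term.rename_rename t]
      congr 2
      funext i
      cases i using Fin.cases <;> rfl
  | _, _, _, .cc, r, s => by simp [Term.rename]
  | _, _, _, .kont π, r, s => by simp [Term.rename]
  | _, _, _, .instrA i, r, s => by simp [Term.rename]
  | _, _, _, .instrB i, r, s => by simp [Term.rename]

/-- A substitution of variables for variables is a renaming. -/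
theorem Term.subst_var : ∀ {n m : ℕ} (t : Term n) (r : Fin n → Fin m),
    t.subst (fun i => .var (r i)) = t.rename r
  | _, _, .var i, r => by simp [Term.rename, Term.subst]
  | _, _, .app t u, r => by simp [Term.rename, Term.subst, Term.subst_var t, Term.subst_var u]
  | _, _, .lam t, r => by
      simp only [Term.rename, Term.subst, ← Term.subst_var t]
      congr 2
      funext i
      cases i using Fin.cases <;> rfl
  | _, _, .cc, r => by simp [Term.rename, Term.subst]
  | _, _, .kont π, r => by simp [Term.rename, Term.subst]
  | _, _, .instrA i, r => by simp [Term.rename, Term.subst]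
  | _, _, .instrB i, r => by simp [Term.rename, Term.subst]

theorem Term.rename_subst : ∀ {n m l : ℕ} (t : Term n) (s : Fin n → Term m) (r : Fin m → Fin l),
    (t.subst s).rename r = t.subst fun i => (s i).rename r
  | _, _, _, .var i, s, r => by simp [Term.subst]
  | _, _, _, .app t u, s, r => by
      simp [Term.rename, Term.subst, Term.rename_subst t, Term.rename_subst u]
  | _, _, _, .lam t, s, r => by
      simp only [Term.rename, Term.subst, Term.rename_subst t]
      congr 2
      funext i
      cases i using Fin.cases with
      | zero => simp [Term.rename]
      | succ i => simp [Term.rename_rename]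
  | _, _, _, .cc, s, r => by simp [Term.rename, Term.subst]
  | _, _, _, .kont π, s, r => by simp [Term.rename, Term.subst]
  | _, _, _, .instrA i, s, r => by simp [Term.rename, Term.subst]
  | _, _, _, .instrB i, s, r => by simp [Term.rename, Term.subst]

theorem Term.rename_id : ∀ {n : ℕ} (t : Term n), t.rename (fun i => i) = t
  | _, .var i => by simp [Term.rename]
  | _, .app t u => by simp [Term.rename, Term.rename_id t, Term.rename_id u]
  | n, .lam t => by
      have h : (Fin.cases 0 fun i => i.succ : Fin (n + 1) → Fin (n + 1)) = fun i => i := by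
        funext i
        cases i using Fin.cases <;> rfl
      simp only [Term.rename, h, Term.rename_id t]
  | _, .cc => by simp [Term.rename]
  | _, .kont π => by simp [Term.rename]
  | _, .instrA i => by simp [Term.rename]
  | _, .instrB i => by simp [Term.rename]

theorem Term.ProofLike.rename : ∀ {n m : ℕ} {t : Term n} (r : Fin n → Fin m),
    t.ProofLike → (t.rename r).ProofLike
  | _, _, .var i, r, _ => by simp [Term.rename, Term.ProofLike]
  | _, _, .app t u, r, h => by
      simp only [Term.ProofLike] at h
      simp [Term.rename, Term.ProofLike, Term.ProofLike.rename r h.1, Term.ProofLike.rename r h.2]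
  | _, _, .lam t, r, h => by
      simp only [Term.ProofLike] at h
      simp only [Term.rename, Term.ProofLike]
      exact Term.ProofLike.rename _ h
  | _, _, .cc, r, _ => by simp [Term.rename, Term.ProofLike]
  | _, _, .kont π, r, h => by simp [Term.ProofLike] at h
  | _, _, .instrA i, r, _ => by simp [Term.rename, Term.ProofLike]
  | _, _, .instrB i, r, h => by simp [Term.ProofLike] at h

@[simp]
theorem cases_one {α : Type*} (a : α) (f : Fin 1 → α) :
    Fin.cases (motive := fun _ => α) a f 1 = f 0 := rfl

/-- A closed term, seen as a term with at most `n` free variables. -/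
def Term.lift {n : ℕ} (t : Term 0) : Term n := t.rename Fin.elim0

@[simp]
theorem Term.rename_succ_closed (t : Term 0) : t.rename Fin.succ = t.lift :=
  congrArg (fun r => Term.rename r t) (Subsingleton.elim _ _)

@[simp]
-- There is no free variable to replace. With this, `simp` computes the reducts of combinators that
-- have closed terms embedded in them.
theorem Term.subst_lift {n m : ℕ} (t : Term 0) (s : Fin n → Term m) :
    (t.lift : Term n).subst s = t.lift := by
  rw [Term.lift, Term.subst_rename, Term.lift, ← Term.subst_var]
  exact congrArg (fun s => Term.subst s t) (funext fun i : Fin 0 => i.elim0)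

@[simp]
theorem Term.lift_zero (t : Term 0) : t.lift = t :=
  (congrArg (fun r => Term.rename r t) (Subsingleton.elim _ _)).trans t.rename_id

/-! ### Rules of realizability -/

/-- The falsity value of an implication. -/
def Pole.arrow (P : Pole) (X Y : Set Stack) : Set Stack :=
  {σ | ∃ t ∈ P.dual X, ∃ π ∈ Y, σ = .cons t π}

theorem Pole.mem_of_step (P : Pole) {p q : Proc} (h : Step p q) (hq : q ∈ P.carrier) :
    p ∈ P.carrier :=
  P.anti_eval p q (.single h) hq

theorem Pole.dual_anti (P : Pole) {X Y : Set Stack} (h : X ⊆ Y) : P.dual Y ⊆ P.dual X :=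
  fun _ ht π hπ => ht π (h hπ)

theorem Pole.mem_dual_empty (P : Pole) (t : Term 0) : t ∈ P.dual ∅ :=
  fun _ h => h.elim

/-- Soundness of modus ponens comes from closure of the pole under the push rule; that of
abstraction, in `lam_mem`, from closure under the grab rule. -/
theorem Pole.app_mem (P : Pole) {X Y : Set Stack} {t u : Term 0} (ht : t ∈ P.dual (P.arrow X Y))
    (hu : u ∈ P.dual X) : Term.app t u ∈ P.dual Y :=
  fun π hπ => P.mem_of_step (.push t u π) (ht _ ⟨u, hu, π, hπ, rfl⟩)

theorem Pole.lam_mem (P : Pole) {X Y : Set Stack} {t : Term 1}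
    (h : ∀ u ∈ P.dual X, t.inst u ∈ P.dual Y) : Term.lam t ∈ P.dual (P.arrow X Y) := by
  rintro _ ⟨u, hu, π, hπ, rfl⟩
  exact P.mem_of_step (.grab t u π) (h u hu π hπ)

/-- The falsity value of a disjunction. -/
def Pole.disj (P : Pole) (X Y : Set Stack) : Set Stack :=
  ⋃ Z : Set Stack, P.arrow (P.arrow X Z) (P.arrow (P.arrow Y Z) Z)

/-- The falsity value of a conjunction. -/
def Pole.conj (P : Pole) (X Y : Set Stack) : Set Stack :=
  ⋃ Z : Set Stack, P.arrow (P.arrow X (P.arrow Y Z)) Z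

/-- The falsity value of the equality of two integers. -/
def Pole.equality (P : Pole) (m n : ℕ) : Set Stack :=
  ⋃ F : ℕ → Set Stack, P.arrow (F m) (F n)

theorem Pole.app_app_mem_of_disj (P : Pole) {X Y Z : Set Stack} {t u v : Term 0}
    (ht : t ∈ P.dual (P.disj X Y)) (hu : u ∈ P.dual (P.arrow X Z))
    (hv : v ∈ P.dual (P.arrow Y Z)) : Term.app (.app t u) v ∈ P.dual Z :=
  P.app_mem (P.app_mem (P.dual_anti (Set.subset_iUnion _ Z) ht) hu) hv

theorem Pole.app_mem_of_conj (P : Pole) {X Y Z : Set Stack} {t u : Term 0}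
    (ht : t ∈ P.dual (P.conj X Y)) (hu : u ∈ P.dual (P.arrow X (P.arrow Y Z))) :
    Term.app t u ∈ P.dual Z :=
  P.app_mem (P.dual_anti
    (Set.subset_iUnion (fun Z => P.arrow (P.arrow X (P.arrow Y Z)) Z) Z) ht) hu

/-- A true equality acts as the identity type `X → X`, and a false one as `⊤ → X` for every `X`; so
the argument `u` matters only when `m = n`. -/
theorem Pole.app_mem_of_equality (P : Pole) {m n : ℕ} {X : Set Stack} {t u : Term 0}
    (ht : t ∈ P.dual (P.equality m n)) (hu : m = n → u ∈ P.dual X) :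
    Term.app t u ∈ P.dual X := by
  -- Leibniz equality is tested on the predicate that is `X` at `n` and `⊤` elsewhere.
  have h := P.dual_anti (Set.subset_iUnion (fun F : ℕ → Set Stack => P.arrow (F m) (F n))
    fun i => if i = n then X else ∅) ht
  simp only [if_true] at h
  refine P.app_mem h ?_
  by_cases h : m = n
  · simpa [h] using hu h
  · simpa [h] using P.mem_dual_empty u

/-- The left injection into a disjunction. -/
def Term.inl (t : Term 0) : Term 0 := .lam (.lam (.app (.var 1) t.lift))

/-- The right injection into a disjunction. -/
def Term.inr (t : Term 0) : Term 0 := .lam (.lam (.app (.var 0) t.lift))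

/-- The pairing of two closed terms. -/
def Term.pair (t u : Term 0) : Term 0 := .lam (.app (.app (.var 0) t.lift) u.lift)

theorem Pole.inl_mem (P : Pole) {X : Set Stack} (Y : Set Stack) {t : Term 0} (ht : t ∈ P.dual X) :
    t.inl ∈ P.dual (P.disj X Y) := by
  intro π hπ
  obtain ⟨Z, hZ⟩ := Set.mem_iUnion.1 hπ
  refine P.lam_mem (fun u hu => P.lam_mem fun v hv => ?_) π hZ
  have h := P.app_mem hu ht
  simpa [Term.inst, Term.subst] using h

theorem Pole.inr_mem (P : Pole) (X : Set Stack) {Y : Set Stack} {t : Term 0} (ht : t ∈ P.dual Y) :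
    t.inr ∈ P.dual (P.disj X Y) := by
  intro π hπ
  obtain ⟨Z, hZ⟩ := Set.mem_iUnion.1 hπ
  refine P.lam_mem (fun u hu => P.lam_mem fun v hv => ?_) π hZ
  have h := P.app_mem hv ht
  simpa [Term.inst, Term.subst] using h

theorem Pole.pair_mem (P : Pole) {X Y : Set Stack} {t u : Term 0} (ht : t ∈ P.dual X)
    (hu : u ∈ P.dual Y) : t.pair u ∈ P.dual (P.conj X Y) := by
  intro π hπ
  obtain ⟨Z, hZ⟩ := Set.mem_iUnion.1 hπ
  refine P.lam_mem (fun v hv => ?_) π hZ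
  have h := P.app_mem (P.app_mem hv ht) hu
  simpa [Term.inst, Term.subst] using h

theorem Pole.identity_mem (P : Pole) (m : ℕ) :
    Term.lam (.var 0) ∈ P.dual (P.equality m m) := by
  intro π hπ
  obtain ⟨F, hF⟩ := Set.mem_iUnion.1 hπ
  refine P.lam_mem (fun v hv => ?_) π hF
  simpa [Term.inst, Term.subst] using hv

/-! ### Falsity values of the encoded connectives -/

/-- Needed to discard the fresh variable `Z` that the encoded connectives introduce. -/
theorem Formula.falsity_rename (P : Pole) {k : ℕ} {Γ : List ℕ} (A : Formula k Γ) :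
    ∀ {Δ : List ℕ} (r : ∀ n, RelVar Γ n → RelVar Δ n) (ρ : Fin k → ℕ) (e : RelEnv Γ)
      (e' : RelEnv Δ), (∀ n X, e' n (r n X) = e n X) →
      (A.rename r).falsity P ρ e' = A.falsity P ρ e := by
  induction A with
  | rel X a => intro Δ r ρ e e' h; simp [Formula.rename, Formula.falsity, h]
  | top => intros; rfl
  | bot => intros; rfl
  | imp A B ihA ihB =>
    intro Δ r ρ e e' h
    simp [Formula.rename, Formula.falsity, ihA r ρ e e' h, ihB r ρ e e' h]
  | all1 A ih =>
    intro Δ r ρ e e' h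
    simp only [Formula.rename, Formula.falsity, fun m => ih r (Fin.snoc ρ m) e e' h]
  | all2 n A ih =>
    intro Δ r ρ e e' h
    simp only [Formula.rename, Formula.falsity]
    refine Set.iUnion_congr fun F => ih _ ρ _ _ fun m X => ?_
    cases X with
    | here => rfl
    | there X => exact h m X
  | eqImp a b A ih =>
    intro Δ r ρ e e' h
    simp [Formula.rename, Formula.falsity, ih r ρ e e' h]
  | inter A B ihA ihB =>
    intro Δ r ρ e e' h
    simp [Formula.rename, Formula.falsity, ihA r ρ e e' h, ihB r ρ e e' h]
  | union A B ihA ihB =>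
    intro Δ r ρ e e' h
    simp [Formula.rename, Formula.falsity, ihA r ρ e e' h, ihB r ρ e e' h]
  | param F a => intros; rfl

section Falsity

variable (P : Pole) {k : ℕ} {Γ : List ℕ} (ρ : Fin k → ℕ) (e : RelEnv Γ)

theorem Formula.falsity_weaken {m : ℕ} (A : Formula k Γ) (F : (Fin m → ℕ) → Set Stack) :
    (A.weaken m).falsity P ρ (e.cons F) = A.falsity P ρ e :=
  A.falsity_rename P _ ρ e _ fun _ _ => rfl

theorem Formula.falsity_imp (A B : Formula k Γ) :
    (A.imp B).falsity P ρ e = P.arrow (A.falsity P ρ e) (B.falsity P ρ e) := rfl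

theorem Formula.falsity_z (F : (Fin 0 → ℕ) → Set Stack) :
    (Formula.z : Formula k (0 :: Γ)).falsity P ρ (e.cons F) = F Fin.elim0 := by
  simp only [Formula.z, Formula.falsity, RelEnv.cons]
  exact congrArg F (Subsingleton.elim _ _)

theorem Formula.falsity_or (A B : Formula k Γ) :
    (A.or B).falsity P ρ e = P.disj (A.falsity P ρ e) (B.falsity P ρ e) := by
  simp only [Formula.or, Formula.falsity.eq_6, Formula.falsity_imp, Formula.falsity_weaken,
    Formula.falsity_z, Pole.disj]
  -- A nullary predicate amounts to a single set of stacks, so the union may be reindexed.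
  exact (Function.Surjective.iUnion_comp (f := fun F : (Fin 0 → ℕ) → Set Stack => F Fin.elim0)
    (fun Z => ⟨fun _ => Z, rfl⟩)
    fun Z => P.arrow (P.arrow (A.falsity P ρ e) Z) (P.arrow (P.arrow (B.falsity P ρ e) Z) Z))

theorem Formula.falsity_and (A B : Formula k Γ) :
    (A.and B).falsity P ρ e = P.conj (A.falsity P ρ e) (B.falsity P ρ e) := by
  simp only [Formula.and, Formula.falsity.eq_6, Formula.falsity_imp, Formula.falsity_weaken,
    Formula.falsity_z, Pole.conj]
  exact (Function.Surjective.iUnion_comp (f := fun F : (Fin 0 → ℕ) → Set Stack => F Fin.elim0)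
    (fun Z => ⟨fun _ => Z, rfl⟩)
    fun Z => P.arrow (P.arrow (A.falsity P ρ e) (P.arrow (B.falsity P ρ e) Z)) Z)

theorem Formula.falsity_eq (a b : FOTerm k) :
    (Formula.eq a b : Formula k Γ).falsity P ρ e = P.equality (a.value ρ) (b.value ρ) := by
  simp only [Formula.eq, Formula.falsity.eq_6, Formula.falsity_imp, Formula.falsity.eq_1,
    RelEnv.cons, Pole.equality]
  exact (Function.Surjective.iUnion_comp
    (f := fun (F : (Fin 1 → ℕ) → Set Stack) m => F fun _ => m)
    (fun G => ⟨fun v => G (v 0), rfl⟩) fun G => P.arrow (G (a.value ρ)) (G (b.value ρ)))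

theorem Formula.mem_falsity_allGim_two (A : Formula (k + 1) Γ) (π : Stack) :
    π ∈ (Formula.allGim 2 A).falsity P ρ e ↔
      ∃ m < 2, π ∈ A.falsity P (Fin.snoc (α := fun _ => ℕ) ρ m) e := by
  simp only [Formula.allGim, Formula.falsity, Set.mem_iUnion, Set.mem_ofPred_eq]
  refine exists_congr fun m => and_congr_left fun _ => ?_
  simp only [FOTerm.app2, FOTerm.value, FOTerm.num, Matrix.cons_val_zero, Matrix.cons_val_one,
    Fin.snoc_last]
  -- The relativization `min (m + 1) 2 = m + 1` says exactly `m < 2`.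
  omega

end Falsity

/-- The falsity value of the disjunction of `x₀ = x₁` and `x₁ = x₀`. -/
def Pole.someEqual₂ (P : Pole) (x : Fin 2 → ℕ) : Set Stack :=
  P.disj (P.equality (x 0) (x 1)) (P.equality (x 1) (x 0))

/-- The falsity value of the disjunction of all `xᵢ = xⱼ` for distinct `i` and `j` below three. -/
def Pole.someEqual₃ (P : Pole) (x : Fin 3 → ℕ) : Set Stack :=
  P.disj (P.disj (P.disj (P.disj (P.disj (P.equality (x 0) (x 1)) (P.equality (x 0) (x 2)))
    (P.equality (x 1) (x 0))) (P.equality (x 1) (x 2))) (P.equality (x 2) (x 0)))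
    (P.equality (x 2) (x 1))

theorem mem_falsity_gimLt_two (P : Pole) (π : Stack) :
    π ∈ (gimLt 2).falsity P Fin.elim0 RelEnv.nil ↔
      ∃ a < 2, ∃ b < 2, π ∈ P.someEqual₂ ![a, b] := by
  have h : gimLt 2 = .allGim 2 (.allGim 2 (.or (.eq (.var 0) (.var 1)) (.eq (.var 1) (.var 0)))) :=
    rfl
  simp only [h, Formula.mem_falsity_allGim_two, Formula.falsity_or, Formula.falsity_eq]
  rfl

theorem mem_falsity_gimLt_three (P : Pole) (π : Stack) :
    π ∈ (gimLt 3).falsity P Fin.elim0 RelEnv.nil ↔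
      ∃ a < 2, ∃ b < 2, ∃ c < 2, π ∈ P.someEqual₃ ![a, b, c] := by
  -- The six ordered pairs come in lexicographic order and the disjunction associates to the left;
  -- this fixes the nesting of injections and case analyses below.
  have h : gimLt 3 = .allGim 2 (.allGim 2 (.allGim 2 (.or (.or (.or (.or (.or
      (.eq (.var 0) (.var 1)) (.eq (.var 0) (.var 2))) (.eq (.var 1) (.var 0)))
      (.eq (.var 1) (.var 2))) (.eq (.var 2) (.var 0))) (.eq (.var 2) (.var 1))))) :=
    rfl
  simp only [h, Formula.mem_falsity_allGim_two, Formula.falsity_or, Formula.falsity_eq]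
  rfl

theorem realizes_gimEq_two_iff (P : Pole) (t : Term 0) :
    Realizes P t (gimEq 2) ↔
      t ∈ P.dual (P.conj (P.arrow ((gimLt 2).falsity P Fin.elim0 RelEnv.nil) Set.univ)
        ((gimLt 3).falsity P Fin.elim0 RelEnv.nil)) := by
  rw [Realizes, gimEq, Formula.falsity_and, gimGe, Formula.falsity_imp]
  rfl

/-! ### From fork to `|ℷ2| = 2` -/

/-- Between singletons the evaluation relation is transfer of membership, pole by pole. -/
theorem isFork_evalRel_iff (S : RealizabilityStructure) (ψ : Term 0) :
    IsFork (evalRel S) ψ ↔ ∀ P ∈ S, ∀ (u v : Term 0) (π : Stack),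
      (⟨u, π⟩ : Proc) ∈ P.carrier ∨ (⟨v, π⟩ : Proc) ∈ P.carrier →
        (⟨ψ, .cons u (.cons v π)⟩ : Proc) ∈ P.carrier := by
  simp only [IsFork, evalRel, Set.singleton_subset_iff, Set.singleton_inter_nonempty]
  exact ⟨fun h P hP u v π => Or.rec ((h u v π).1 P hP) ((h u v π).2 P hP),
    fun h u v π => ⟨fun P hP hu => h P hP u v π (.inl hu), fun P hP hv => h P hP u v π (.inr hv)⟩⟩

/-- A realizer of `|ℷ2| ≥ 2`. -/
def Term.gimGeTwo : Term 0 :=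
  .lam (.app (.app (.var 0) (.lam (.app (.var 0) .cc))) (.lam (.app (.var 0) .cc)))

/-- A realizer of `|ℷ2| < 2` is refuted at the pair (0,1), where both disjuncts are false
equalities. The argument `cc` is an arbitrary proof-like dummy. -/
theorem Pole.gimGeTwo_mem (P : Pole) :
    Term.gimGeTwo ∈ P.dual (P.arrow ((gimLt 2).falsity P Fin.elim0 RelEnv.nil) Set.univ) := by
  refine P.lam_mem fun u hu => ?_
  have key : ∀ m n : ℕ, m ≠ n →
      Term.lam (.app (.var 0) .cc) ∈ P.dual (P.arrow (P.equality m n) Set.univ) := by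
    refine fun m n hmn => P.lam_mem fun t ht => ?_
    simpa [Term.inst, Term.subst] using
      P.app_mem_of_equality (X := Set.univ) (u := .cc) ht fun h => (hmn h).elim
  have h := P.app_app_mem_of_disj (X := P.equality 0 1) (Y := P.equality 1 0)
    (fun π hπ => hu π ((mem_falsity_gimLt_two P π).2 ⟨0, by simp, 1, by simp, hπ⟩))
    (key 0 1 (by simp)) (key 1 0 (by simp))
  simpa [Term.inst, Term.subst] using h

/-- A realizer of `|ℷ2| < 3`, where `ψ` is a fork instruction. -/
def Term.gimLtThree (ψ : Term 0) : Term 0 :=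
  .app (.app ψ (Term.lam (.var 0)).inl.inl.inl.inl.inl)
    (.app (.app ψ (Term.lam (.var 0)).inr.inl.inl.inl.inl) (Term.lam (.var 0)).inr.inl.inl)

/-- The fork makes a union of truth values inhabitable uniformly: the term does not depend on which
alternative holds. -/
theorem Pole.app_app_fork_mem (P : Pole) {ψ : Term 0}
    (hψ : ∀ (u v : Term 0) (π : Stack), (⟨u, π⟩ : Proc) ∈ P.carrier ∨ (⟨v, π⟩ : Proc) ∈ P.carrier →
      (⟨ψ, .cons u (.cons v π)⟩ : Proc) ∈ P.carrier)
    {X : Set Stack} {u v : Term 0} (h : u ∈ P.dual X ∨ v ∈ P.dual X) :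
    Term.app (.app ψ u) v ∈ P.dual X :=
  fun π hπ => P.mem_of_step (.push _ _ _) (P.mem_of_step (.push _ _ _)
    (hψ u v π (h.imp (fun h => h π hπ) fun h => h π hπ)))

theorem Pole.gimLtThree_mem (P : Pole) {ψ : Term 0}
    (hψ : ∀ (u v : Term 0) (π : Stack), (⟨u, π⟩ : Proc) ∈ P.carrier ∨ (⟨v, π⟩ : Proc) ∈ P.carrier →
      (⟨ψ, .cons u (.cons v π)⟩ : Proc) ∈ P.carrier) :
    ψ.gimLtThree ∈ P.dual ((gimLt 3).falsity P Fin.elim0 RelEnv.nil) := by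
  intro π hπ
  obtain ⟨a, ha, b, hb, c, hc, hπ⟩ := (mem_falsity_gimLt_three P π).1 hπ
  -- Pigeonhole on three bits; the three cases match the three injections in `gimLtThree`.
  have h : a = b ∨ a = c ∨ b = c := by omega
  refine P.app_app_fork_mem hψ ?_ π hπ
  rcases h with rfl | rfl | rfl
  · exact .inl (P.inl_mem _ (P.inl_mem _ (P.inl_mem _ (P.inl_mem _
      (P.inl_mem _ (P.identity_mem a))))))
  · exact .inr (P.app_app_fork_mem hψ (.inl (P.inl_mem _ (P.inl_mem _ (P.inl_mem _ (P.inl_mem _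
      (P.inr_mem _ (P.identity_mem a))))))))
  · exact .inr (P.app_app_fork_mem hψ (.inr (P.inl_mem _ (P.inl_mem _
      (P.inr_mem _ (P.identity_mem b))))))

theorem Term.ProofLike.pair_gim {ψ : Term 0} (h : ψ.ProofLike) :
    (Term.gimGeTwo.pair ψ.gimLtThree).ProofLike := by
  simp [Term.pair, Term.gimGeTwo, Term.gimLtThree, Term.inl, Term.inr, Term.lift, Term.rename,
    Term.ProofLike, h.rename]

/-! ### From `|ℷ2| = 2` to fork -/

/-- Case analysis on the equality `m = n`, returning `u` when it holds. -/
def Term.transport {n : ℕ} (u : Term n) : Term n := .lam (.app (.var 0) (u.rename Fin.succ))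

theorem Term.subst_transport {n m : ℕ} (u : Term n) (s : Fin n → Term m) :
    u.transport.subst s = (u.subst s).transport := by
  simp [Term.transport, Term.subst, Term.subst_rename, Term.rename_subst]

theorem Pole.transport_mem (P : Pole) {m n : ℕ} {X : Set Stack} {u : Term 0}
    (h : m = n → u ∈ P.dual X) : u.transport ∈ P.dual (P.arrow (P.equality m n) X) := by
  refine P.lam_mem fun t ht => ?_
  simpa [Term.inst, Term.subst] using P.app_mem_of_equality ht h

/-- Case analysis on a disjunction. -/
def Term.cases {n : ℕ} (u v : Term n) : Term n :=
  .lam (.app (.app (.var 0) (u.rename Fin.succ)) (v.rename Fin.succ))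

theorem Term.subst_cases {n m : ℕ} (u v : Term n) (s : Fin n → Term m) :
    (u.cases v).subst s = (u.subst s).cases (v.subst s) := by
  simp [Term.cases, Term.subst, Term.subst_rename, Term.rename_subst]

theorem Pole.cases_mem (P : Pole) {X Y Z : Set Stack} {u v : Term 0}
    (hu : u ∈ P.dual (P.arrow X Z)) (hv : v ∈ P.dual (P.arrow Y Z)) :
    u.cases v ∈ P.dual (P.arrow (P.disj X Y) Z) := by
  refine P.lam_mem fun t ht => ?_
  simpa [Term.inst, Term.subst] using P.app_app_mem_of_disj ht hu hv

/-- Given a realizer `t` of the disjunction of all `xᵢ = xⱼ`, for distinct `i` and `j` below three,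
returns `u` when `x₀ = x₁` and `v` when `x₀ = x₂`. -/
def Term.chooseEqual {n : ℕ} (t u v : Term n) : Term n :=
  .app (Term.cases (((((u.transport.cases v.transport).cases u.transport).cases
    u.transport).cases v.transport)) u.transport) t

theorem Term.subst_chooseEqual {n m : ℕ} (t u v : Term n) (s : Fin n → Term m) :
    (t.chooseEqual u v).subst s = (t.subst s).chooseEqual (u.subst s) (v.subst s) := by
  simp only [Term.chooseEqual, Term.subst, Term.subst_cases, Term.subst_transport]

/-- Since `b ≠ c`, the branches for `x₁ = x₂` and `x₂ = x₁` are vacuous, and the `u` placed there is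
a mere filler. -/
theorem Pole.chooseEqual_mem (P : Pole) {X : Set Stack} {t u v : Term 0} {a b c : ℕ}
    (ht : t ∈ P.dual (P.someEqual₃ ![a, b, c])) (hab : a = b → u ∈ P.dual X)
    (hac : a = c → v ∈ P.dual X) (hbc : b ≠ c) : t.chooseEqual u v ∈ P.dual X :=
  P.app_mem (P.cases_mem (P.cases_mem (P.cases_mem (P.cases_mem (P.cases_mem
    (P.transport_mem hab) (P.transport_mem hac)) (P.transport_mem fun h => hab h.symm))
    (P.transport_mem fun h => (hbc h).elim)) (P.transport_mem fun h => hac h.symm))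
    (P.transport_mem fun h => (hbc h.symm).elim)) ht

/-- A fork instruction, where `t` is a realizer of `|ℷ2| < 3`. -/
def Term.fork (t : Term 0) : Term 0 := .lam (.lam (t.lift.chooseEqual (.var 1) (.var 0)))

theorem Term.ProofLike.fork {t : Term 0} (h : t.ProofLike) : t.fork.ProofLike := by
  simp [Term.fork, Term.chooseEqual, Term.cases, Term.transport, Term.lift, Term.rename,
    Term.ProofLike, h.rename]

theorem Pole.fork_mem (P : Pole) {t : Term 0}
    (ht : t ∈ P.dual ((gimLt 3).falsity P Fin.elim0 RelEnv.nil)) (u v : Term 0) (π : Stack)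
    (h : (⟨u, π⟩ : Proc) ∈ P.carrier ∨ (⟨v, π⟩ : Proc) ∈ P.carrier) :
    (⟨t.fork, .cons u (.cons v π)⟩ : Proc) ∈ P.carrier := by
  refine P.mem_of_step (.grab _ _ _) (P.mem_of_step (.grab _ _ _) ?_)
  have ht' : ∀ a < 2, ∀ b < 2, ∀ c < 2, t ∈ P.dual (P.someEqual₃ ![a, b, c]) :=
    fun a ha b hb c hc π hπ =>
      ht π ((mem_falsity_gimLt_three P π).2 ⟨a, ha, b, hb, c, hc, hπ⟩)
  -- The falsity value is the single stack `π`, because `u` or `v` is only known to be accepted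
  -- there.
  have key : t.chooseEqual u v ∈ P.dual {π} := by
    rcases h with h | h
    -- At (0,0,1) only `x₀ = x₁` holds, which selects `u`; at (0,1,0), below, only `x₀ = x₂` holds,
    -- which selects `v`.
    · exact P.chooseEqual_mem (ht' 0 (by simp) 0 (by simp) 1 (by simp))
        (fun _ => by rintro _ rfl; exact h) (by simp) (by simp)
    · exact P.chooseEqual_mem (ht' 0 (by simp) 1 (by simp) 0 (by simp))
        (by simp) (fun _ => by rintro _ rfl; exact h) (by simp)
  simpa [Term.inst, Term.subst, Term.subst_chooseEqual] using key π rfl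

end LambdaC

theorem mainTheorem7 (S : LambdaC.RealizabilityStructure) :
    LambdaC.gimEq 2 ∈ LambdaC.theory S ↔
      ∃ ψ : LambdaC.Term 0, ψ.ProofLike ∧ LambdaC.IsFork (LambdaC.evalRel S) ψ := by
  simp only [LambdaC.isFork_evalRel_iff, LambdaC.theory, LambdaC.realizes_gimEq_two_iff,
    Set.mem_ofPred_eq]
  constructor
  · rintro ⟨t, ht, h⟩
    -- Applying `t` to `λx.λy.y` projects the conjunction onto `|ℷ2| < 3`.
    refine ⟨LambdaC.Term.fork (.app t (.lam (.lam (.var 0)))),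
      LambdaC.Term.ProofLike.fork (by simpa [LambdaC.Term.ProofLike] using ht), fun P hP =>
        P.fork_mem (P.app_mem_of_conj (h P hP) (P.lam_mem fun u _ => P.lam_mem fun v hv => ?_))⟩
    simpa [LambdaC.Term.inst, LambdaC.Term.subst] using hv
  · rintro ⟨ψ, hψ, h⟩
    exact ⟨_, hψ.pair_gim, fun P hP => P.pair_mem P.gimGeTwo_mem (P.gimLtThree_mem (h P hP))⟩
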